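/- A left brace is a set $B$ with two operations $+$ and $\cdot$ such that $(B,+)$ is an abelian group, $(B,\cdot)$ is a group, and $a\cdot(b+c)+a=a\cdot b+a\cdot c$ for all $a,b,c\in B$. Put $\lambda_a(b)=a\cdot b-a$ and $\operatorname{Soc}(B)=\{a\in B\mid \lambda_a=\operatorname{id}\}$. Two left braces are isomorphic if there is a bijection between them that respects both operations. Let $D_4$ and $Q$ be the dihedral and the quaternion group of order $8$. Products written without a dot are ordinary products of integers; an element of $\mathbb{Z}/(2)$, $\mathbb{Z}/(4)$ or $\mathbb{Z}/(8)$ is represented by an integer in $\{0,1\}$, $\{0,\dots,3\}$ or $\{0,\dots,7\}$, and the result is reduced modulo the order of the coordinate. **Theorem (Case $p=2$).** The following is a complete list of left braces $G$ of order $8$ up to isomorphism: each of the $27$ multiplications below, together with the usual addition of the indicated group, defines a left brace with the indicated socle order and multiplicative group $(G,\cdot)$, and every left brace of order $8$ is isomorphic to exactly one of them. 1. $(G,+)=\mathbb{Z}/(8)$: - Socle of order $2$: $x_1\cdot x_2=x_1+x_2+2x_1x_2$, with $(G,\cdot)\cong\mathbb{Z}/(2)\times\mathbb{Z}/(4)$.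 - Socle of order $4$: $x_1\cdot x_2=x_1+(1+2\alpha)^{x_1}x_2$ for $\alpha=1,2,3$, with $(G,\cdot)\cong Q$, $\mathbb{Z}/(8)$, $D_4$ respectively. - Socle of order $8$: $x_1\cdot x_2=x_1+x_2$, with $(G,\cdot)\cong\mathbb{Z}/(8)$. 2. $(G,+)=\mathbb{Z}/(2)\times\mathbb{Z}/(4)$: - Socle of order $1$, where elements of $\mathbb{Z}/(4)$ are written $z+2x$ with $z,x\in\{0,1\}$: $(y_1,\,z_1+2x_1)\cdot(y_2,\,z_2+2x_2)=(y_1+y_2+(x_1+y_1+z_1+y_1z_1)z_2,\ z_1+2x_1+2z_1y_2+2(y_1+x_1z_1)z_2+z_2+2x_2)$, with $(G,\cdot)\cong D_4$. - Socle of order $2$: $(x_1,y_1)\cdot(x_2,y_2)$ equal to - $(x_1+x_2,\ y_1+y_2+2x_1x_2+2y_1y_2)$, with $(G,\cdot)\cong\mathbb{Z}/(2)\times\mathbb{Z}/(4)$; - $(x_1+x_2,\ y_1+y_2+2(x_1+y_1)x_2+2y_1y_2)$, with $(G,\cdot)\cong D_4$; - $(x_1+x_2,\ y_1+y_2+2y_1x_2+2x_1y_2)$,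 with $(G,\cdot)\cong\mathbb{Z}/(2)\times\mathbb{Z}/(4)$; - $(x_1+x_2,\ y_1+y_2+2y_1x_2+2(x_1+y_1)y_2)$, with $(G,\cdot)\cong(\mathbb{Z}/(2))^3$; - $(x_1+x_2+y_1y_2,\ y_1+y_2+2y_1x_2+2x_1y_2)$, with $(G,\cdot)\cong\mathbb{Z}/(2)\times\mathbb{Z}/(4)$; - $(x_1+x_2+y_2\sum_{i=1}^{y_1-1}i,\ y_1+y_2+2y_1y_2)$, with $(G,\cdot)\cong D_4$. - Socle of order $4$: $(x_1,y_1)\cdot(x_2,y_2)$ equal to - $(x_1+x_2,\ y_1+y_2+2x_1y_2)$, with $(G,\cdot)\cong D_4$; - $(x_1+x_2,\ y_1+y_2+2y_1y_2)$, with $(G,\cdot)\cong(\mathbb{Z}/(2))^3$; - $(x_1+x_2,\ y_1+y_2+2y_1x_2)$, with $(G,\cdot)\cong D_4$; - $(x_1+x_2,\ y_1+y_2+2x_1x_2)$, with $(G,\cdot)\cong\mathbb{Z}/(2)\times\mathbb{Z}/(4)$; - $(x_1+x_2,\ y_1+y_2+2(x_1+y_1)x_2)$, with $(G,\cdot)\cong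 Q$; - $(x_1+x_2+y_1y_2,\ y_1+y_2)$, with $(G,\cdot)\cong\mathbb{Z}/(2)\times\mathbb{Z}/(4)$. - Socle of order $8$: $(x_1+x_2,\ y_1+y_2)$, with $(G,\cdot)\cong\mathbb{Z}/(2)\times\mathbb{Z}/(4)$. 3. $(G,+)=(\mathbb{Z}/(2))^3$, with $(x_1,y_1,z_1)\cdot(x_2,y_2,z_2)$ equal to: - Socle of order $1$: $(x_1+x_2+z_1y_2+x_1z_2+y_1z_2+x_1z_1z_2,\ y_1+y_2+z_1z_2+x_1z_2+y_1z_1z_2,\ z_1+z_2)$, with $(G,\cdot)\cong D_4$. - Socle of order $2$: - $(x_1+x_2+z_1y_2+y_1z_2,\ y_1+y_2,\ z_1+z_2)$, with $(G,\cdot)\cong(\mathbb{Z}/(2))^3$; - $(x_1+x_2+y_1y_2+z_1z_2,\ y_1+y_2,\ z_1+z_2)$, with $(G,\cdot)\cong\mathbb{Z}/(2)\times\mathbb{Z}/(4)$; - $(x_1+x_2+(y_1+z_1)y_2+z_1z_2,\ y_1+y_2,\ z_1+z_2)$, with $(G,\cdot)\cong Q$; - $(x_1+x_2+z_1y_2+y_1z_2,\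 y_1+y_2+z_1z_2,\ z_1+z_2)$, with $(G,\cdot)\cong\mathbb{Z}/(2)\times\mathbb{Z}/(4)$. - Socle of order $4$: - $(x_1+x_2+y_1y_2,\ y_1+y_2,\ z_1+z_2)$, with $(G,\cdot)\cong\mathbb{Z}/(2)\times\mathbb{Z}/(4)$; - $(x_1+x_2+z_1y_2,\ y_1+y_2,\ z_1+z_2)$, with $(G,\cdot)\cong D_4$. - Socle of order $8$: $(x_1+x_2,\ y_1+y_2,\ z_1+z_2)$, with $(G,\cdot)\cong(\mathbb{Z}/(2))^3$. In particular, a left brace of order $8$ with trivial socle has multiplicative group $D_4$ and is isomorphic either to the one listed with additive group $\mathbb{Z}/(2)\times\mathbb{Z}/(4)$ or to the one listed with additive group $(\mathbb{Z}/(2))^3$. -/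

import Mathlib

/-- A left brace: a set with an abelian group structure `+` and a group structure `*` such that
`a * (b + c) + a = a * b + a * c`. -/
class IsLeftBrace (B : Type*) [AddCommGroup B] [Group B] : Prop where
  brace_property : ∀ a b c : B, a * (b + c) + a = a * b + a * c

namespace IsLeftBrace

/-- The map `λ_a(b) = a * b - a`. -/
def lambdaMap {B : Type*} [AddCommGroup B] [Group B] (a : B) : B → B :=
  fun b => a * b - a

/-- The socle `{a | λ_a = id}`. -/
def socle (B : Type*) [AddCommGroup B] [Group B] : Set B :=
  {a | lambdaMap a = id}

end IsLeftBrace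

/-- Names for the five isomorphism types of groups of order `8`. -/
inductive GroupName
  | Z8 | Z2xZ4 | Z2xZ2xZ2 | D4 | Q

/-- The group `G` is isomorphic to the group with the given name. -/
def GroupName.IsTypeOf (G : Type*) [Group G] : GroupName → Prop
  | .Z8 => Nonempty (G ≃* Multiplicative (ZMod 8))
  | .Z2xZ4 => Nonempty (G ≃* Multiplicative (ZMod 2 × ZMod 4))
  | .Z2xZ2xZ2 => Nonempty (G ≃* Multiplicative (ZMod 2 × ZMod 2 × ZMod 2))
  | .D4 => Nonempty (G ≃* DihedralGroup 4)
  | .Q => Nonempty (G ≃* QuaternionGroup 2)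

/-- An entry of the list: an abelian group, a binary operation on it, the asserted order of the
socle and the asserted isomorphism type of the multiplicative group. -/
structure BraceEntry where
  carrier : Type
  [addGroup : AddCommGroup carrier]
  mul : carrier → carrier → carrier
  socleOrder : ℕ
  mulGroup : GroupName

attribute [instance] BraceEntry.addGroup

namespace BraceEntry

/-- The operation of the entry makes its abelian group into a left brace, with the socle order and
the multiplicative group that the entry asserts. -/
def IsCorrect (E : BraceEntry) : Prop :=
  ∃ _ : Group E.carrier,
    (∀ x y : E.carrier, x * y = E.mul x y) ∧
    IsLeftBrace E.carrier ∧
    Nat.card (IsLeftBrace.socle E.carrier) = E.socleOrder ∧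
    E.mulGroup.IsTypeOf E.carrier

/-- `G` is isomorphic to the entry, by a bijection that respects both operations. -/
def IsIsoTo (E : BraceEntry) (G : Type*) [AddCommGroup G] [Group G] : Prop :=
  ∃ e : G ≃+ E.carrier, ∀ x y : G, e (x * y) = E.mul (e x) (e y)

/-- An entry with additive group `ℤ/8`. -/
def onZ8 (s : ℕ) (M : GroupName) (m : ZMod 8 → ZMod 8 → ZMod 8) : BraceEntry :=
  { carrier := ZMod 8, mul := m, socleOrder := s, mulGroup := M }

/-- An entry with additive group `ℤ/2 × ℤ/4`; the operation is given in coordinates,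
`(x₁, y₁) · (x₂, y₂) = m x₁ y₁ x₂ y₂`. -/
def onZ2xZ4 (s : ℕ) (M : GroupName)
    (m : ZMod 2 → ZMod 4 → ZMod 2 → ZMod 4 → ZMod 2 × ZMod 4) : BraceEntry :=
  { carrier := ZMod 2 × ZMod 4, mul := fun a b => m a.1 a.2 b.1 b.2,
    socleOrder := s, mulGroup := M }

/-- An entry with additive group `(ℤ/2)³`; the operation is given in coordinates,
`(x₁, y₁, z₁) · (x₂, y₂, z₂) = m x₁ y₁ z₁ x₂ y₂ z₂`. -/
def onZ2xZ2xZ2 (s : ℕ) (M : GroupName)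
    (m : ZMod 2 → ZMod 2 → ZMod 2 → ZMod 2 → ZMod 2 → ZMod 2 → ZMod 2 × ZMod 2 × ZMod 2) :
    BraceEntry :=
  { carrier := ZMod 2 × ZMod 2 × ZMod 2, mul := fun a b => m a.1 a.2.1 a.2.2 b.1 b.2.1 b.2.2,
    socleOrder := s, mulGroup := M }

end BraceEntry

/-- Labels for the entries of the list: additive group, order of the socle, running number. -/
inductive BraceLabel
  | Z8_soc2 | Z8_soc4_1 | Z8_soc4_2 | Z8_soc4_3 | Z8_soc8
  | Z2xZ4_soc1
  | Z2xZ4_soc2_1 | Z2xZ4_soc2_2 | Z2xZ4_soc2_3 | Z2xZ4_soc2_4 | Z2xZ4_soc2_5 | Z2xZ4_soc2_6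
  | Z2xZ4_soc4_1 | Z2xZ4_soc4_2 | Z2xZ4_soc4_3 | Z2xZ4_soc4_4 | Z2xZ4_soc4_5 | Z2xZ4_soc4_6
  | Z2xZ4_soc8
  | Z2xZ2xZ2_soc1
  | Z2xZ2xZ2_soc2_1 | Z2xZ2xZ2_soc2_2 | Z2xZ2xZ2_soc2_3 | Z2xZ2xZ2_soc2_4
  | Z2xZ2xZ2_soc4_1 | Z2xZ2xZ2_soc4_2
  | Z2xZ2xZ2_soc8

open BraceEntry in
/-- The list of left braces of order `8`. An element of `ℤ/2` or `ℤ/4` that occurs in the other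
ring stands for its representative `x.val` in `{0, 1}` or `{0, 1, 2, 3}`; exponents
and bounds of summation are read in the same way, through representatives in `{0, …, 7}` and
`{0, 1, 2, 3}`. None of these formulas depends on the choice of representatives. -/
def braceOfOrder8 : BraceLabel → BraceEntry
  | .Z8_soc2 => onZ8 2 .Z2xZ4 fun x₁ x₂ => x₁ + x₂ + 2 * x₁ * x₂
  | .Z8_soc4_1 => onZ8 4 .Q fun x₁ x₂ => x₁ + (1 + 2 * 1) ^ x₁.val * x₂
  | .Z8_soc4_2 => onZ8 4 .Z8 fun x₁ x₂ => x₁ + (1 + 2 * 2) ^ x₁.val * x₂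
  | .Z8_soc4_3 => onZ8 4 .D4 fun x₁ x₂ => x₁ + (1 + 2 * 3) ^ x₁.val * x₂
  | .Z8_soc8 => onZ8 8 .Z8 fun x₁ x₂ => x₁ + x₂
  -- here an element `w` of `ℤ/4` is written as `w = z + 2 * x` with digits `z, x ∈ {0, 1}`
  | .Z2xZ4_soc1 => onZ2xZ4 1 .D4 fun y₁ w₁ y₂ w₂ =>
      let z₁ : ℕ := w₁.val % 2
      let x₁ : ℕ := w₁.val / 2
      let z₂ : ℕ := w₂.val % 2
      let x₂ : ℕ := w₂.val / 2
      (y₁ + y₂ + (x₁ + y₁ + z₁ + y₁ * z₁) * z₂,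
        z₁ + 2 * x₁ + 2 * z₁ * y₂.val + 2 * (y₁.val + x₁ * z₁) * z₂ + z₂ + 2 * x₂)
  | .Z2xZ4_soc2_1 => onZ2xZ4 2 .Z2xZ4 fun x₁ y₁ x₂ y₂ =>
      (x₁ + x₂, y₁ + y₂ + 2 * x₁.val * x₂.val + 2 * y₁ * y₂)
  | .Z2xZ4_soc2_2 => onZ2xZ4 2 .D4 fun x₁ y₁ x₂ y₂ =>
      (x₁ + x₂, y₁ + y₂ + 2 * (x₁.val + y₁) * x₂.val + 2 * y₁ * y₂)
  | .Z2xZ4_soc2_3 => onZ2xZ4 2 .Z2xZ4 fun x₁ y₁ x₂ y₂ =>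
      (x₁ + x₂, y₁ + y₂ + 2 * y₁ * x₂.val + 2 * x₁.val * y₂)
  | .Z2xZ4_soc2_4 => onZ2xZ4 2 .Z2xZ2xZ2 fun x₁ y₁ x₂ y₂ =>
      (x₁ + x₂, y₁ + y₂ + 2 * y₁ * x₂.val + 2 * (x₁.val + y₁) * y₂)
  | .Z2xZ4_soc2_5 => onZ2xZ4 2 .Z2xZ4 fun x₁ y₁ x₂ y₂ =>
      (x₁ + x₂ + y₁.val * y₂.val, y₁ + y₂ + 2 * y₁ * x₂.val + 2 * x₁.val * y₂)
  | .Z2xZ4_soc2_6 => onZ2xZ4 2 .D4 fun x₁ y₁ x₂ y₂ =>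
      (x₁ + x₂ + y₂.val * ((∑ i ∈ Finset.Ico 1 y₁.val, i : ℕ) : ZMod 2), y₁ + y₂ + 2 * y₁ * y₂)
  | .Z2xZ4_soc4_1 => onZ2xZ4 4 .D4 fun x₁ y₁ x₂ y₂ =>
      (x₁ + x₂, y₁ + y₂ + 2 * x₁.val * y₂)
  | .Z2xZ4_soc4_2 => onZ2xZ4 4 .Z2xZ2xZ2 fun x₁ y₁ x₂ y₂ =>
      (x₁ + x₂, y₁ + y₂ + 2 * y₁ * y₂)
  | .Z2xZ4_soc4_3 => onZ2xZ4 4 .D4 fun x₁ y₁ x₂ y₂ =>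
      (x₁ + x₂, y₁ + y₂ + 2 * y₁ * x₂.val)
  | .Z2xZ4_soc4_4 => onZ2xZ4 4 .Z2xZ4 fun x₁ y₁ x₂ y₂ =>
      (x₁ + x₂, y₁ + y₂ + 2 * x₁.val * x₂.val)
  | .Z2xZ4_soc4_5 => onZ2xZ4 4 .Q fun x₁ y₁ x₂ y₂ =>
      (x₁ + x₂, y₁ + y₂ + 2 * (x₁.val + y₁) * x₂.val)
  | .Z2xZ4_soc4_6 => onZ2xZ4 4 .Z2xZ4 fun x₁ y₁ x₂ y₂ =>
      (x₁ + x₂ + y₁.val * y₂.val, y₁ + y₂)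
  | .Z2xZ4_soc8 => onZ2xZ4 8 .Z2xZ4 fun x₁ y₁ x₂ y₂ =>
      (x₁ + x₂, y₁ + y₂)
  | .Z2xZ2xZ2_soc1 => onZ2xZ2xZ2 1 .D4 fun x₁ y₁ z₁ x₂ y₂ z₂ =>
      (x₁ + x₂ + z₁ * y₂ + x₁ * z₂ + y₁ * z₂ + x₁ * z₁ * z₂,
        y₁ + y₂ + z₁ * z₂ + x₁ * z₂ + y₁ * z₁ * z₂, z₁ + z₂)
  | .Z2xZ2xZ2_soc2_1 => onZ2xZ2xZ2 2 .Z2xZ2xZ2 fun x₁ y₁ z₁ x₂ y₂ z₂ =>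
      (x₁ + x₂ + z₁ * y₂ + y₁ * z₂, y₁ + y₂, z₁ + z₂)
  | .Z2xZ2xZ2_soc2_2 => onZ2xZ2xZ2 2 .Z2xZ4 fun x₁ y₁ z₁ x₂ y₂ z₂ =>
      (x₁ + x₂ + y₁ * y₂ + z₁ * z₂, y₁ + y₂, z₁ + z₂)
  | .Z2xZ2xZ2_soc2_3 => onZ2xZ2xZ2 2 .Q fun x₁ y₁ z₁ x₂ y₂ z₂ =>
      (x₁ + x₂ + (y₁ + z₁) * y₂ + z₁ * z₂, y₁ + y₂, z₁ + z₂)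
  | .Z2xZ2xZ2_soc2_4 => onZ2xZ2xZ2 2 .Z2xZ4 fun x₁ y₁ z₁ x₂ y₂ z₂ =>
      (x₁ + x₂ + z₁ * y₂ + y₁ * z₂, y₁ + y₂ + z₁ * z₂, z₁ + z₂)
  | .Z2xZ2xZ2_soc4_1 => onZ2xZ2xZ2 4 .Z2xZ4 fun x₁ y₁ z₁ x₂ y₂ z₂ =>
      (x₁ + x₂ + y₁ * y₂, y₁ + y₂, z₁ + z₂)
  | .Z2xZ2xZ2_soc4_2 => onZ2xZ2xZ2 4 .D4 fun x₁ y₁ z₁ x₂ y₂ z₂ =>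
      (x₁ + x₂ + z₁ * y₂, y₁ + y₂, z₁ + z₂)
  | .Z2xZ2xZ2_soc8 => onZ2xZ2xZ2 8 .Z2xZ2xZ2 fun x₁ y₁ z₁ x₂ y₂ z₂ =>
      (x₁ + x₂, y₁ + y₂, z₁ + z₂)

/-!
A left brace `G` of order `8` is an abelian group on which its multiplicative group, a `2`-group,
acts through `λ`. Fixed points of actions of `2`-groups give a flag (`exists_isFlag`): an element
`v` of order `2` fixed by all `λ_a`, an element `w` with the same properties modulo `v`, and an
element `u` outside the subgroup generated by `v` and `w`. Every element of `G` is
`i v + j w + k u` with digits `i, j, k ∈ {0, 1}`, and in these digits the additive group is given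
by `2w` and `2u`, and each `λ_a` by `λ_a(w) - w` and `λ_a(u) - u`. As `v`, `w`, `u` generate the
multiplicative group, `G` is determined by the doubling map and by `λ_v`, `λ_w`, `λ_u`, that is, by
a code of four times three digits (`FlagCode`, `IsFlag.isCoord`). Left braces that have flags with
the same code are isomorphic (`IsCoord.exists_equiv`).

The rest is a finite computation with codes. The brace laws, applied to `v`, `w`, `u` only, are
necessary conditions on a code, and every code that satisfies them is the code of a flag of some
entry of the list (`exists_label_check`). Conversely, no entry has a flag with the code that the
table `flagCodeOf` gives for an earlier entry (`hasFlag_check`). Isomorphic left braces have flags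
with the same codes, so no two entries are isomorphic. That an entry is a left brace with the
asserted socle and multiplicative group is also verified in digits (`leftDistrib_check`,
`socle_check`, `group_check`), after its multiplication has been identified with that of its code
(`exists_hasCoord`).
-/

open IsLeftBrace

/-! ### Codes of flags and their arithmetic in digits -/

/-- The digits `(i, j, k)` of an element `i v + j w + k u` with respect to a flag `v, w, u`. -/
abbrev Bits := Bool × Bool × Bool

/-- The digits `wv, uv, uw` in a pair of equations `T w = wv v`, `T u = uv v + uw w`. Such a pair
describes the doubling map `T x = x + x` as well as the maps `T x = λ_a(x) - x`. -/
structure Row where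
  wv : Bool := false
  uv : Bool := false
  uw : Bool := false

/-- The data of a left brace of order `8` with respect to a flag `v, w, u`: the doubling map and
the maps `λ_v`, `λ_w`, `λ_u`. All combinations of digits are allowed here; most of them do not come
from a left brace. -/
structure FlagCode where
  dbl : Row := {}
  actV : Row := {}
  actW : Row := {}
  actU : Row := {}

namespace Bits

/-- The digits of `0`. -/
def zero : Bits := (false, false, false)

/-- The digits of `v`. -/
def v : Bits := (true, false, false)

/-- The digits of `w`. -/
def w : Bits := (false, true, false)

/-- The digits of `u`. -/
def u : Bits := (false, false, true)

/-- The list of all eight digit vectors. -/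
def all : List Bits :=
  [(false, false, false), (true, false, false), (false, true, false), (true, true, false),
    (false, false, true), (true, false, true), (false, true, true), (true, true, true)]

theorem mem_all : ∀ x : Bits, x ∈ all := by decide

/-- Boolean equality, written out digit by digit so that it is cheap to evaluate. -/
def eq (x y : Bits) : Bool := (x.1 == y.1) && ((x.2.1 == y.2.1) && (x.2.2 == y.2.2))

theorem eq_iff {x y : Bits} : eq x y = true ↔ x = y := by
  simp [eq, Prod.ext_iff]

/-- The multiple `b x` of `x` by a digit `b`. -/
def smul (b : Bool) (x : Bits) : Bits := bif b then x else zero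

/-- `f x`, with `x` first replaced by the literal that it evaluates to. In a computation by the
kernel this makes equal arguments syntactically equal, so that each product of two given digit
vectors is computed only once. -/
def force (x : Bits) (f : Bits → Bool) : Bool :=
  bif x.1 then
    bif x.2.1 then bif x.2.2 then f (true, true, true) else f (true, true, false)
    else bif x.2.2 then f (true, false, true) else f (true, false, false)
  else
    bif x.2.1 then bif x.2.2 then f (false, true, true) else f (false, true, false)
    else bif x.2.2 then f (false, false, true) else f (false, false, false)

theorem force_eq (x : Bits) (f : Bits → Bool) : force x f = f x := by
  obtain ⟨_ | _, _ | _, _ | _⟩ := x <;> rfl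

end Bits

namespace FlagCode

/-- Addition in digits. The digits of `u` produce a carry according to `2u = uv v + uw w`, those
of `w` one according to `2w = wv v`. -/
def add (c : FlagCode) (x y : Bits) : Bits :=
  let k := x.2.2 && y.2.2
  let j := k && c.dbl.uw
  (x.1 ^^ y.1 ^^ (k && c.dbl.uv) ^^
      (((x.2.1 && y.2.1) ^^ ((x.2.1 ^^ y.2.1) && j)) && c.dbl.wv),
    x.2.1 ^^ y.2.1 ^^ j, x.2.2 ^^ y.2.2)

/-- The additive map with `v ↦ v`, `w ↦ w + wv v`, `u ↦ u + uv v + uw w` in digits. -/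
def act (c : FlagCode) (r : Row) (y : Bits) : Bits :=
  (y.1 ^^ (y.2.1 && r.wv) ^^ (y.2.2 && r.uv) ^^ (y.2.1 && (y.2.2 && r.uw) && c.dbl.wv),
    y.2.1 ^^ (y.2.2 && r.uw), y.2.2)

/-- The map `λ_x` in digits. The element `x` with digits `i, j, k` is the product `u^k w^j v^i'`
where `i' = i + j k b` and `b` is the digit in `λ_u(w) = w + b v`. -/
def lam (c : FlagCode) (x y : Bits) : Bits :=
  let y₁ := bif x.1 ^^ (x.2.1 && x.2.2 && c.actU.wv) then c.act c.actV y else y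
  let y₂ := bif x.2.1 then c.act c.actW y₁ else y₁
  bif x.2.2 then c.act c.actU y₂ else y₂

/-- Multiplication in digits: `x * y = x + λ_x(y)`. -/
def mul (c : FlagCode) (x y : Bits) : Bits := c.add x (c.lam x y)

end FlagCode

/-! ### Elements given by digits -/

section Digit
variable {G : Type*} [AddCommGroup G]

/-- The multiple `b x` of `x` by a digit `b`. -/
def digit (b : Bool) (x : G) : G := bif b then x else 0

@[simp] theorem digit_true (x : G) : digit true x = x := rfl
@[simp] theorem digit_false (x : G) : digit false x = 0 := rfl

theorem digit_zero (a : Bool) : digit a (0 : G) = 0 := by cases a <;> rfl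

theorem digit_add (a : Bool) (x y : G) : digit a (x + y) = digit a x + digit a y := by
  cases a <;> simp

theorem digit_digit (a b : Bool) (x : G) : digit a (digit b x) = digit (a && b) x := by
  cases a <;> rfl

theorem digit_add_digit (a b : Bool) (x : G) :
    digit a x + digit b x = digit (a ^^ b) x + digit (a && b) (x + x) := by
  cases a <;> cases b <;> simp

theorem digit_xor {x : G} (hx : x + x = 0) (a b : Bool) :
    digit (a ^^ b) x = digit a x + digit b x := by
  rw [digit_add_digit, hx, digit_zero, add_zero]

theorem map_digit {H : Type*} [AddCommGroup H] (f : G →+ H) (b : Bool) (x : G) :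
    f (digit b x) = digit b (f x) := by
  cases b <;> simp

/-- The element `i v + j w + k u` with digits `y = (i, j, k)`. -/
def comb (v w u : G) (y : Bits) : G := digit y.1 v + digit y.2.1 w + digit y.2.2 u

theorem map_comb {H : Type*} [AddCommGroup H] (f : G →+ H) (v w u : G) (y : Bits) :
    f (comb v w u y) = comb (f v) (f w) (f u) y := by
  simp only [comb, map_add, map_digit]

theorem comb_add {c : FlagCode} {v w u : G} (hv : v + v = 0) (hw : w + w = digit c.dbl.wv v)
    (hu : u + u = digit c.dbl.uv v + digit c.dbl.uw w) (x y : Bits) :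
    comb v w u (c.add x y) = comb v w u x + comb v w u y := by
  obtain ⟨x₁, x₂, x₃⟩ := x
  obtain ⟨y₁, y₂, y₃⟩ := y
  have hu' := digit_add_digit x₃ y₃ u
  have hw' := digit_add_digit x₂ y₂ w
  have hw'' := digit_add_digit (x₂ ^^ y₂) (x₃ && y₃ && c.dbl.uw) w
  rw [hu, digit_add, digit_digit, digit_digit] at hu'
  rw [hw, digit_digit] at hw' hw''
  simp only [comb, FlagCode.add, digit_xor hv, Bool.and_xor_distrib_right] at hw'' ⊢
  grind

theorem comb_act {c : FlagCode} {v w u : G} (hv : v + v = 0) (hw : w + w = digit c.dbl.wv v)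
    (r : Row) (y : Bits) :
    comb v w u (c.act r y) =
      comb v (w + digit r.wv v) (u + digit r.uv v + digit r.uw w) y := by
  obtain ⟨y₁, y₂, y₃⟩ := y
  have hw' := digit_add_digit y₂ (y₃ && r.uw) w
  rw [hw, digit_digit] at hw'
  simp only [comb, FlagCode.act, digit_xor hv, digit_add, digit_digit, Bool.and_assoc] at hw' ⊢
  grind

end Digit

/-! ### The map `λ` of a left brace -/

namespace IsLeftBrace
variable {G : Type*} [AddCommGroup G] [Group G] [IsLeftBrace G]

theorem mul_add_eq (a b c : G) : a * (b + c) = a * b + a * c - a :=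
  eq_sub_of_add_eq (brace_property a b c)

theorem mul_zero_eq (a : G) : a * (0 : G) = a := by
  have h := brace_property a 0 0
  rw [add_zero] at h
  exact (add_left_cancel h).symm

theorem zero_eq_one : (0 : G) = 1 := by
  simpa using mul_zero_eq (1 : G)

/-- `λ_a` as an additive map. -/
def lambdaAdd (a : G) : G →+ G :=
  AddMonoidHom.mk' (lambdaMap a) fun b c => by simp only [lambdaMap, mul_add_eq]; abel

theorem lambdaAdd_apply (a b : G) : lambdaAdd a b = a * b - a := rfl

theorem mul_eq_add_lambdaAdd (a b : G) : a * b = a + lambdaAdd a b := by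
  rw [lambdaAdd_apply, add_sub_cancel]

theorem lambdaAdd_one : lambdaAdd (1 : G) = AddMonoidHom.id G := by
  ext b
  rw [lambdaAdd_apply, one_mul, ← zero_eq_one, sub_zero, AddMonoidHom.id_apply]

theorem lambdaAdd_mul (a b : G) : lambdaAdd (a * b) = (lambdaAdd a).comp (lambdaAdd b) := by
  ext c
  have h : a * (b * c) = a * (b * c - b) + a * b - a := by
    rw [← mul_add_eq, sub_add_cancel]
  rw [AddMonoidHom.comp_apply, lambdaAdd_apply, lambdaAdd_apply, lambdaAdd_apply, mul_assoc, h]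
  abel

variable (G) in
/-- The action `a ↦ λ_a` of the multiplicative group on the additive group. -/
def lambdaHom : G →* AddMonoid.End G where
  toFun := lambdaAdd
  map_one' := lambdaAdd_one
  map_mul' := lambdaAdd_mul

end IsLeftBrace

/-! ### A flag determines the left brace -/

/-- `v, w, u` is a flag of `G` with code `c`: the subgroups `0 < ⟨v⟩ < ⟨v, w⟩ < G` have index `2`
in each other, and `c` records the doubling map and `λ_v`, `λ_w`, `λ_u`. The maps `λ_a` are
described through the products `a * b = a + λ_a(b)`, and only for `a` and `b` in the flag. -/
structure IsFlag {G : Type*} [AddCommGroup G] [Group G] (c : FlagCode) (v w u : G) : Prop where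
  v_ne : v ≠ 0
  w_ne : w ≠ 0
  w_ne_v : w ≠ v
  u_ne (i j : Bool) : u ≠ digit i v + digit j w
  v_add : v + v = 0
  w_add : w + w = digit c.dbl.wv v
  u_add : u + u = digit c.dbl.uv v + digit c.dbl.uw w
  mul_v : v * v = v + v ∧ w * v = w + v ∧ u * v = u + v
  mul_w : v * w = v + (w + digit c.actV.wv v) ∧ w * w = w + (w + digit c.actW.wv v) ∧
    u * w = u + (w + digit c.actU.wv v)
  mul_u : v * u = v + (u + digit c.actV.uv v + digit c.actV.uw w) ∧
    w * u = w + (u + digit c.actW.uv v + digit c.actW.uw w) ∧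
    u * u = u + (u + digit c.actU.uv v + digit c.actU.uw w)

/-- `d` identifies `G` with the digit vectors, on which `c` defines addition and
multiplication. -/
structure IsCoord {G : Type*} [AddCommGroup G] [Group G] (c : FlagCode) (d : Bits → G) : Prop where
  bijective : Function.Bijective d
  map_add (x y : Bits) : d (c.add x y) = d x + d y
  map_mul (x y : Bits) : d (c.mul x y) = d x * d y

namespace IsFlag
variable {G : Type*} [AddCommGroup G] [Group G] {c : FlagCode} {v w u : G}

theorem comb_injective (h : IsFlag c v w u) : Function.Injective (comb v w u) := by
  have hv := h.v_add
  have h₁ := h.v_ne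
  have h₂ := h.w_ne
  have h₃ := h.w_ne_v
  -- `u` is not in the subgroup generated by `v` and `w`
  have hu (i j i' j' : Bool) : digit i v + digit j w + u ≠ digit i' v + digit j' w := by
    intro hx
    apply h.u_ne (i ^^ i' ^^ (j && c.dbl.wv) ^^ (j && j' && c.dbl.wv)) (j ^^ j')
    have e₁ : digit i v + digit i v = 0 := by rw [← digit_add, hv, digit_zero]
    have e₂ : digit j w + digit j w + digit (j && c.dbl.wv) v = 0 := by
      rw [← digit_add, h.w_add, digit_digit, ← digit_add, hv, digit_zero]
    have e₃ := digit_add_digit j j' w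
    rw [h.w_add, digit_digit] at e₃
    calc u = digit i' v + digit j' w - digit i v - digit j w := by rw [← hx]; abel
      _ = digit i' v + digit j' w - digit i v - digit j w + (digit i v + digit i v) +
          (digit j w + digit j w + digit (j && c.dbl.wv) v) := by rw [e₁, e₂, add_zero, add_zero]
      _ = digit i v + digit i' v + digit (j && c.dbl.wv) v + (digit j w + digit j' w) := by abel
      _ = _ := by rw [e₃]; simp only [digit_xor hv]; abel
  have hvw : v + w ≠ 0 := fun e => h₃ (add_left_cancel (e.trans hv.symm))
  rintro ⟨i, j, k⟩ ⟨i', j', k'⟩ hx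
  simp only [comb] at hx
  cases k <;> cases k'
  · cases i <;> cases j <;> cases i' <;> cases j' <;> simp_all [eq_comm]
  · exact absurd (by simpa using hx.symm) (hu i' j' i j)
  · exact absurd (by simpa using hx) (hu i j i' j')
  · cases i <;> cases j <;> cases i' <;> cases j' <;> simp_all [eq_comm]

variable [IsLeftBrace G]

/-- Since `λ` is a homomorphism, `λ_v`, `λ_w` and `λ_u` determine `λ_x` for all `x`. -/
theorem comb_mul (h : IsFlag c v w u) (x y : Bits) :
    comb v w u (c.mul x y) = comb v w u x * comb v w u y := by
  have act (z : G) (r : Row) (h₁ : z * v = z + v) (h₂ : z * w = z + (w + digit r.wv v))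
      (h₃ : z * u = z + (u + digit r.uv v + digit r.uw w)) (y : Bits) :
      comb v w u (c.act r y) = lambdaAdd z (comb v w u y) := by
    rw [map_comb, comb_act h.v_add h.w_add]
    simp only [lambdaAdd_apply, h₁, h₂, h₃, add_sub_cancel_left]
  have actV := act v c.actV h.mul_v.1 h.mul_w.1 h.mul_u.1
  have actW := act w c.actW h.mul_v.2.1 h.mul_w.2.1 h.mul_u.2.1
  have actU := act u c.actU h.mul_v.2.2 h.mul_w.2.2 h.mul_u.2.2
  -- the element with digits `i, j, k` is a product of powers of `u`, `w` and `v`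
  have key : lambdaAdd (comb v w u x) = (lambdaAdd (bif x.2.2 then u else 1)).comp
      ((lambdaAdd (bif x.2.1 then w else 1)).comp
        (lambdaAdd (bif x.1 ^^ (x.2.1 && x.2.2 && c.actU.wv) then v else 1))) := by
    rw [← lambdaAdd_mul, ← lambdaAdd_mul]
    congr 1
    obtain ⟨i, j, k⟩ := x
    have h0 := zero_eq_one (G := G)
    obtain ⟨-, hwv, huv⟩ := h.mul_v
    have huw := h.mul_w.2.2
    have e : u * (w + v) = u + w + digit c.actU.wv v + v := by
      rw [mul_add_eq, huw, huv]; abel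
    have hv := h.v_add
    cases hb : c.actU.wv <;> rw [hb] at huw e <;> cases i <;> cases j <;> cases k <;>
      simp [comb, *] <;> grind
  have l1 : lambdaAdd (1 : G) = AddMonoidHom.id G := lambdaAdd_one
  rw [FlagCode.mul, comb_add h.v_add h.w_add h.u_add, mul_eq_add_lambdaAdd, key]
  congr 1
  simp only [AddMonoidHom.comp_apply, FlagCode.lam]
  cases x.2.2 <;> cases x.2.1 <;> cases (x.1 ^^ (_ && c.actU.wv)) <;>
    simp [actV, actW, actU, l1]

/-- A necessary condition on a code, from `λ_z(u + u) = λ_z(u) + λ_z(u)`. -/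
theorem digit_eq_digit (h : IsFlag c v w u) (r : Row) (z : G) (h₁ : z * v = z + v)
    (h₂ : z * w = z + (w + digit r.wv v))
    (h₃ : z * u = z + (u + digit r.uv v + digit r.uw w)) :
    (c.dbl.uw && r.wv) = (r.uw && c.dbl.wv) := by
  have hv := h.v_add
  have e := map_add (lambdaAdd z) u u
  rw [h.u_add, map_add, map_digit, map_digit] at e
  simp only [lambdaAdd_apply, h₁, h₂, h₃, add_sub_cancel_left, digit_add, digit_digit] at e
  have e₁ : digit r.uv v + digit r.uv v = 0 := by rw [← digit_add, hv, digit_zero]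
  have e₂ : digit r.uw w + digit r.uw w = digit (r.uw && c.dbl.wv) v := by
    rw [← digit_add, h.w_add, digit_digit]
  have e₃ : u + digit r.uv v + digit r.uw w + (u + digit r.uv v + digit r.uw w) =
      (u + u) + (digit r.uv v + digit r.uv v) + (digit r.uw w + digit r.uw w) := by abel
  rw [e₃, e₁, e₂, h.u_add, add_zero, ← add_assoc, add_left_cancel_iff] at e
  revert e
  have := h.v_ne
  cases (c.dbl.uw && r.wv) <;> cases (r.uw && c.dbl.wv) <;> simp [eq_comm, this]

/-- `λ_v(w) = w + v` would give `v * w = v + (w + v) = w` and hence `v = 1 = 0`. -/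
theorem actV_wv (h : IsFlag c v w u) : c.actV.wv = false := by
  by_contra hb
  have hvw : v * w = w := by
    rw [h.mul_w.1, Bool.eq_true_of_not_eq_false hb, digit_true, add_left_comm, h.v_add, add_zero]
  exact h.v_ne ((mul_eq_right.1 hvw).trans zero_eq_one.symm)

/-- A necessary condition on a code: `v` and `w` commute, so that `λ_v` and `λ_w` do. -/
theorem actV_uw_and_actW_wv (h : IsFlag c v w u) : (c.actV.uw && c.actW.wv) = false := by
  have hvw : v * w = w * v := by
    rw [h.mul_w.1, h.mul_v.2.1, h.actV_wv, digit_false, add_zero, add_comm]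
  have e := congrArg (fun z => lambdaAdd z u) hvw
  simp only [lambdaAdd_mul, AddMonoidHom.comp_apply, lambdaAdd_apply v u, lambdaAdd_apply w u,
    h.mul_u.1, h.mul_u.2.1, add_sub_cancel_left, map_add, map_digit] at e
  simp only [lambdaAdd_apply, h.mul_v.1, h.mul_v.2.1, h.mul_w.1, h.mul_w.2.1,
    add_sub_cancel_left, h.actV_wv, digit_false, add_zero, digit_add, digit_digit] at e
  have e' : digit (c.actV.uw && c.actW.wv) v = 0 := by
    rw [← sub_eq_zero.2 e.symm]; abel
  by_contra hb
  rw [Bool.eq_true_of_not_eq_false hb] at e'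
  exact h.v_ne e'

/-- The code of a flag determines the left brace. -/
theorem isCoord (h : IsFlag c v w u) (hG : Nat.card G = 8) : IsCoord c (comb v w u) where
  bijective := by
    have : Finite G := Nat.finite_of_card_ne_zero (by omega)
    exact h.comb_injective.bijective_of_nat_card_le (by simp [hG])
  map_add := comb_add h.v_add h.w_add h.u_add
  map_mul := h.comb_mul

end IsFlag

/-! ### Existence of flags -/

section FixedPoints
variable {Γ A : Type*} [Group Γ] [AddCommGroup A]

/-- A `2`-group that acts on an abelian group of order `2 ^ (n + 1)` fixes an element of order `2`:
it fixes some `a ≠ 0`, and then a multiple of `a` has order `2`. -/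
theorem exists_fixed_of_card_eq_two_pow (hΓ : IsPGroup 2 Γ) (ρ : Γ →* AddMonoid.End A) {n : ℕ}
    (hA : Nat.card A = 2 ^ (n + 1)) : ∃ a : A, a ≠ 0 ∧ a + a = 0 ∧ ∀ g, ρ g a = a := by
  have : Finite A := Nat.finite_of_card_ne_zero (by simp [hA])
  let _ : MulAction Γ A := MulAction.compHom A ρ
  have smul_def (g : Γ) (a : A) : g • a = ρ g a := rfl
  obtain ⟨a, ha, ha0⟩ := hΓ.exists_fixed_point_of_prime_dvd_card_of_fixed_point A
    (hA ▸ dvd_pow_self 2 n.succ_ne_zero) (a := 0) (fun g => by rw [smul_def, map_zero])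
  obtain ⟨k, -, hk⟩ := (Nat.dvd_prime_pow Nat.prime_two).1 (hA ▸ addOrderOf_dvd_natCard a)
  cases k with
  | zero => exact absurd (AddMonoid.addOrderOf_eq_one_iff.1 hk) ha0.symm
  | succ k =>
    refine ⟨2 ^ k • a, fun h => ?_, ?_, fun g => ?_⟩
    · have h2 : 2 ^ (k + 1) ∣ 2 ^ k := hk ▸ addOrderOf_dvd_of_nsmul_eq_zero h
      have := (Nat.pow_dvd_pow_iff_le_right one_lt_two).1 h2
      omega
    · rw [← add_nsmul, ← mul_two, ← pow_succ, ← hk, addOrderOf_nsmul_eq_zero]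
    · rw [map_nsmul, ← smul_def, ha g]

theorem exists_eq_add_digit {a x y : A} (ha : a + a = 0)
    (h : (x : A ⧸ AddSubgroup.zmultiples a) = y) : ∃ b, x = y + digit b a := by
  rw [eq_comm, QuotientAddGroup.eq, AddSubgroup.mem_zmultiples_iff] at h
  obtain ⟨n, hn⟩ := h
  rw [eq_neg_add_iff_add_eq] at hn
  have h2 (m : ℤ) : (2 * m) • a = 0 := by rw [mul_comm, mul_zsmul, two_zsmul, ha, zsmul_zero]
  rcases n.even_or_odd' with ⟨m, rfl | rfl⟩
  · exact ⟨false, by rw [← hn, h2, digit_false]⟩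
  · exact ⟨true, by rw [← hn, add_zsmul, h2, zero_add, one_zsmul, digit_true]⟩

theorem exists_hom_quotient (ρ : Γ →* AddMonoid.End A) {a : A} (ha : ∀ g, ρ g a = a) :
    ∃ ρ' : Γ →* AddMonoid.End (A ⧸ AddSubgroup.zmultiples a),
      ∀ g (x : A), ρ' g x = (ρ g x : A) := by
  have hle (g : Γ) :
      AddSubgroup.zmultiples a ≤ (AddSubgroup.zmultiples a).comap (ρ g : A →+ A) := by
    rw [AddSubgroup.zmultiples_le]
    change ρ g a ∈ AddSubgroup.zmultiples a
    exact (ha g).symm ▸ AddSubgroup.mem_zmultiples a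
  refine ⟨⟨⟨fun g => QuotientAddGroup.map _ _ (ρ g : A →+ A) (hle g), ?_⟩, ?_⟩, fun g x => rfl⟩
  · refine AddMonoidHom.ext fun x => ?_
    induction x using QuotientAddGroup.induction_on with | H x => ?_
    change ((ρ 1 x : A) : A ⧸ AddSubgroup.zmultiples a) = x
    rw [map_one, AddMonoid.End.coe_one, id]
  · intro g h
    refine AddMonoidHom.ext fun x => ?_
    induction x using QuotientAddGroup.induction_on with | H x => ?_
    change ((ρ (g * h) x : A) : A ⧸ AddSubgroup.zmultiples a) = (ρ g (ρ h x) : A)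
    rw [map_mul, AddMonoid.End.coe_mul, Function.comp]

theorem card_quotient_zmultiples [Finite A] {a : A} (ha0 : a ≠ 0) (ha : a + a = 0) :
    Nat.card A = Nat.card (A ⧸ AddSubgroup.zmultiples a) * 2 := by
  rw [AddSubgroup.card_eq_card_quotient_mul_card_addSubgroup (AddSubgroup.zmultiples a),
    Nat.card_zmultiples, addOrderOf_eq_prime (by rw [two_nsmul, ha]) ha0]

end FixedPoints

/-- Every left brace of order `8` has a flag: `v` is a fixed point of `λ` of order `2`, the images
of `w` in `G ⧸ ⟨v⟩` and of `u` in the quotient of `G ⧸ ⟨v⟩` by `w` are such points again. -/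
theorem exists_isFlag {G : Type*} [AddCommGroup G] [Group G] [IsLeftBrace G]
    (hG : Nat.card G = 8) : ∃ c, ∃ v w u : G, IsFlag c v w u := by
  have : Finite G := Nat.finite_of_card_ne_zero (by omega)
  have hp : IsPGroup 2 G := IsPGroup.of_card (n := 3) hG
  obtain ⟨v, hv0, hv, hvf⟩ := exists_fixed_of_card_eq_two_pow hp (lambdaHom G) (n := 2) hG
  have hcard := card_quotient_zmultiples hv0 hv
  obtain ⟨ρ, hρ⟩ := exists_hom_quotient (lambdaHom G) hvf
  obtain ⟨w, hw0, hw, hwf⟩ := exists_fixed_of_card_eq_two_pow hp ρ (n := 1) (by omega)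
  have hcard' := card_quotient_zmultiples hw0 hw
  obtain ⟨σ, hσ⟩ := exists_hom_quotient ρ hwf
  obtain ⟨u, hu0, hu, huf⟩ := exists_fixed_of_card_eq_two_pow hp σ (n := 0) (by omega)
  induction w using QuotientAddGroup.induction_on with | H w => ?_
  induction u using QuotientAddGroup.induction_on with | H u => ?_
  induction u using QuotientAddGroup.induction_on with | H u => ?_
  have modV {x y : G} (h : (x : G ⧸ AddSubgroup.zmultiples v) = y) : ∃ b, x = y + digit b v :=
    exists_eq_add_digit hv h
  have modK {x y : G}
      (h : ((x : G ⧸ AddSubgroup.zmultiples v) :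
          (G ⧸ AddSubgroup.zmultiples v) ⧸
            AddSubgroup.zmultiples (w : G ⧸ AddSubgroup.zmultiples v)) =
        ((y : G ⧸ AddSubgroup.zmultiples v) :)) : ∃ b b', x = y + digit b v + digit b' w := by
    obtain ⟨b', hb'⟩ := exists_eq_add_digit hw h
    have : (digit b' (w : G ⧸ AddSubgroup.zmultiples v)) = (digit b' w : G) := by cases b' <;> rfl
    rw [this, ← QuotientAddGroup.mk_add] at hb'
    obtain ⟨b, hb⟩ := modV hb'
    exact ⟨b, b', by rw [hb]; abel⟩
  have hqv : ((v : G) : G ⧸ AddSubgroup.zmultiples v) = 0 :=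
    (QuotientAddGroup.eq_zero_iff v).2 (AddSubgroup.mem_zmultiples v)
  have hqw : ((w : G ⧸ AddSubgroup.zmultiples v) :
      (G ⧸ AddSubgroup.zmultiples v) ⧸
        AddSubgroup.zmultiples (w : G ⧸ AddSubgroup.zmultiples v)) = 0 :=
    (QuotientAddGroup.eq_zero_iff _).2 (AddSubgroup.mem_zmultiples _)
  have mul_v (x : G) : x * v = x + v := by
    rw [mul_eq_add_lambdaAdd]; exact congrArg _ (hvf x)
  have mul_w (x : G) : ∃ b, x * w = x + (w + digit b v) := by
    obtain ⟨b, hb⟩ := modV ((hρ x w).symm.trans (hwf x))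
    exact ⟨b, by rw [← hb]; exact mul_eq_add_lambdaAdd x w⟩
  have mul_u (x : G) : ∃ b b', x * u = x + (u + digit b v + digit b' w) := by
    obtain ⟨b, b', hb⟩ := modK (x := lambdaHom G x u) (y := u)
      ((congrArg _ (hρ x u).symm).trans ((hσ x u).symm.trans (huf x)))
    exact ⟨b, b', by rw [← hb]; exact mul_eq_add_lambdaAdd x u⟩
  obtain ⟨d₁, hd₁⟩ := modV (x := w + w) (y := 0) hw
  obtain ⟨d₂, d₃, hd₂⟩ := modK (x := u + u) (y := 0) hu
  obtain ⟨a₁, ha₁⟩ := mul_w v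
  obtain ⟨a₂, a₃, ha₂⟩ := mul_u v
  obtain ⟨b₁, hb₁⟩ := mul_w w
  obtain ⟨b₂, b₃, hb₂⟩ := mul_u w
  obtain ⟨c₁, hc₁⟩ := mul_w u
  obtain ⟨c₂, c₃, hc₂⟩ := mul_u u
  rw [zero_add] at hd₁ hd₂
  exact ⟨⟨⟨d₁, d₂, d₃⟩, ⟨a₁, a₂, a₃⟩, ⟨b₁, b₂, b₃⟩, ⟨c₁, c₂, c₃⟩⟩, v, w, u,
    { v_ne := hv0
      w_ne := fun h => hw0 (by rw [h]; rfl)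
      w_ne_v := fun h => hw0 (by rw [h, hqv])
      u_ne := fun i j h => hu0 (by
        rw [h]
        cases i <;> cases j <;> simp [hqv, hqw])
      v_add := hv
      w_add := hd₁
      u_add := hd₂
      mul_v := ⟨mul_v v, mul_v w, mul_v u⟩
      mul_w := ⟨ha₁, hb₁, hc₁⟩
      mul_u := ⟨ha₂, hb₂, hc₂⟩ }⟩

/-! ### Tests on codes -/

namespace FlagCode

/-- The condition that `λ_a`, described by `r`, respects the doubling map `d`. -/
def compat (d r : Row) : Bool := (d.uw && r.wv) == (r.uw && d.wv)

/-- Associativity of `mul` for triples from `l`. -/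
def assocOn (c : FlagCode) (l : List Bits) : Bool :=
  l.all fun x => l.all fun y => l.all fun z =>
    (c.mul y z).force fun yz => (c.mul x y).force fun xy => (c.mul x yz).eq (c.mul xy z)

/-- The law `x * (y + z) + x = x * y + x * z` in digits. -/
def leftDistrib (c : FlagCode) : Bool :=
  Bits.all.all fun x => Bits.all.all fun y => Bits.all.all fun z =>
    (c.add y z).force fun yz => (c.mul x yz).force fun xyz => (c.mul x y).force fun xy =>
      (c.mul x z).force fun xz => (c.add xyz x).eq (c.add xy xz)

/-- The conditions on the first element of a flag in the structure that `m` defines on `Bits`. -/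
def isFlagV (m : FlagCode) (v : Bits) : Bool :=
  !v.eq .zero && ((m.add v v).eq .zero && (m.mul v v).eq (m.add v v))

/-- The further conditions on the second element of a flag with code `c`. -/
def isFlagW (m c : FlagCode) (v w : Bits) : Bool :=
  !w.eq .zero && (!w.eq v && ((m.add w w).eq (v.smul c.dbl.wv) && ((m.mul w v).eq (m.add w v) &&
    ((m.mul v w).eq (m.add v (m.add w (.smul c.actV.wv v))) &&
      (m.mul w w).eq (m.add w (m.add w (.smul c.actW.wv v)))))))

/-- The further conditions on the third element of a flag with code `c`. -/
def isFlagU (m c : FlagCode) (v w u : Bits) : Bool :=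
  ([false, true].all fun i => [false, true].all fun j => !u.eq (m.add (.smul i v) (.smul j w))) &&
    ((m.add u u).eq (m.add (.smul c.dbl.uv v) (.smul c.dbl.uw w)) &&
    ((m.mul u v).eq (m.add u v) &&
    ((m.mul u w).eq (m.add u (m.add w (.smul c.actU.wv v))) &&
    ((m.mul v u).eq (m.add v (m.add (m.add u (.smul c.actV.uv v)) (.smul c.actV.uw w))) &&
    ((m.mul w u).eq (m.add w (m.add (m.add u (.smul c.actW.uv v)) (.smul c.actW.uw w))) &&
    (m.mul u u).eq (m.add u (m.add (m.add u (.smul c.actU.uv v)) (.smul c.actU.uw w))))))))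

/-- The structure that `m` defines on `Bits` has a flag with code `c`. The search over `v`, `w`, `u`
drops a partial flag as soon as it fails. -/
def hasFlag (m c : FlagCode) : Bool :=
  Bits.all.any fun v => isFlagV m v && Bits.all.any fun w => isFlagW m c v w &&
    Bits.all.any fun u => isFlagU m c v w u

end FlagCode

/-! ### Flags of a code -/

open FlagCode

namespace IsCoord
variable {G : Type*} [AddCommGroup G] [Group G] {m : FlagCode} {d : Bits → G}

theorem map_zero (h : IsCoord m d) : d .zero = 0 := by
  have e := h.map_add .zero .zero
  have : m.add .zero .zero = .zero := by simp [FlagCode.add, Bits.zero]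
  rwa [this, left_eq_add] at e

theorem map_smul (h : IsCoord m d) (b : Bool) (x : Bits) : d (.smul b x) = digit b (d x) := by
  cases b
  · exact h.map_zero
  · rfl

theorem isFlag_iff (h : IsCoord m d) (c : FlagCode) (v w u : Bits) :
    (isFlagV m v && (isFlagW m c v w && isFlagU m c v w u)) = true ↔
      IsFlag c (d v) (d w) (d u) := by
  have e (x y : Bits) : x.eq y = true ↔ d x = d y :=
    Bits.eq_iff.trans h.bijective.injective.eq_iff.symm
  have e' (x y : Bits) : x.eq y = false ↔ d x ≠ d y := by
    rw [← Bool.not_eq_true, e]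
  simp only [isFlagV, isFlagW, isFlagU, Bool.and_eq_true, Bool.not_eq_true', List.all_eq_true, e,
    e', h.map_add, h.map_mul, h.map_smul, h.map_zero, List.mem_cons, List.not_mem_nil, or_false]
  constructor
  · rintro ⟨⟨v₁, v₂, v₃⟩, ⟨w₁, w₂, w₃, w₄, w₅, w₆⟩, u₁, u₂, u₃, u₄, u₅, u₆, u₇⟩
    exact ⟨v₁, w₁, w₂, fun i j => u₁ i (by cases i <;> simp) j (by cases j <;> simp), v₂, w₃, u₂,
      ⟨v₃, w₄, u₃⟩, ⟨w₅, w₆, u₄⟩, ⟨u₅, u₆, u₇⟩⟩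
  · rintro ⟨v₁, w₁, w₂, u₁, v₂, w₃, u₂, ⟨v₃, w₄, u₃⟩, ⟨w₅, w₆, u₄⟩, ⟨u₅, u₆, u₇⟩⟩
    exact ⟨⟨v₁, v₂, v₃⟩, ⟨w₁, w₂, w₃, w₄, w₅, w₆⟩, fun i _ j _ => u₁ i j, u₂, u₃, u₄, u₅, u₆, u₇⟩

theorem hasFlag_of_isFlag (h : IsCoord m d) {c : FlagCode} {v w u : G} (hf : IsFlag c v w u) :
    hasFlag m c = true := by
  obtain ⟨v, rfl⟩ := h.bijective.surjective v
  obtain ⟨w, rfl⟩ := h.bijective.surjective w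
  obtain ⟨u, rfl⟩ := h.bijective.surjective u
  have := (h.isFlag_iff c v w u).2 hf
  simp only [Bool.and_eq_true] at this
  simp only [hasFlag, List.any_eq_true, Bool.and_eq_true]
  exact ⟨v, Bits.mem_all v, this.1, w, Bits.mem_all w, this.2.1, u, Bits.mem_all u, this.2.2⟩

theorem exists_isFlag_of_hasFlag (h : IsCoord m d) {c : FlagCode} (hc : hasFlag m c = true) :
    ∃ v w u : G, IsFlag c v w u := by
  simp only [hasFlag, List.any_eq_true, Bool.and_eq_true] at hc
  obtain ⟨v, -, hv, w, -, hw, u, -, hu⟩ := hc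
  exact ⟨d v, d w, d u, (h.isFlag_iff c v w u).1 (by simp only [hv, hw, hu, Bool.and_self])⟩

/-- Two left braces with coordinates for the same code are isomorphic. -/
theorem exists_equiv {H : Type*} [AddCommGroup H] [Group H] {d' : Bits → H} (h : IsCoord m d)
    (h' : IsCoord m d') : ∃ e : G ≃+ H, ∀ x y, e (x * y) = e x * e y := by
  let f := Equiv.ofBijective d h.bijective
  let f' := Equiv.ofBijective d' h'.bijective
  have hf (x : Bits) : f' (f.symm (d x)) = d' x := by
    rw [show d x = f x from rfl, f.symm_apply_apply]; rfl
  refine ⟨AddEquiv.mk' (f.symm.trans f') fun x y => ?_, fun x y => ?_⟩ <;>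
  obtain ⟨x, rfl⟩ := h.bijective.surjective x <;>
  obtain ⟨y, rfl⟩ := h.bijective.surjective y
  · simp only [Equiv.trans_apply, ← h.map_add, hf, h'.map_add]
  · change f' (f.symm (d x * d y)) = f' (f.symm (d x)) * f' (f.symm (d y))
    rw [← h.map_mul, hf, hf, hf, h'.map_mul]

end IsCoord

theorem IsFlag.map {G H : Type*} [AddCommGroup G] [Group G] [AddCommGroup H] [Group H]
    {c : FlagCode} {v w u : G} (h : IsFlag c v w u) (e : G ≃+ H)
    (he : ∀ x y, e (x * y) = e x * e y) : IsFlag c (e v) (e w) (e u) := by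
  have hd (b : Bool) (x : G) : digit b (e x) = e (digit b x) :=
    (map_digit e.toAddMonoidHom b x).symm
  have ⟨h₁, h₂, h₃, h₄, h₅, h₆, h₇, h₈, h₉, h₁₀⟩ := h
  constructor <;>
    simpa only [hd, ← he, ← map_add, e.injective.eq_iff, ne_eq, map_eq_zero_iff e e.injective]

/-! ### Codes of the entries -/

namespace BraceLabel

/-- The list of all labels. -/
def all : List BraceLabel :=
  [.Z8_soc2, .Z8_soc4_1, .Z8_soc4_2, .Z8_soc4_3, .Z8_soc8,
    .Z2xZ4_soc1,
    .Z2xZ4_soc2_1, .Z2xZ4_soc2_2, .Z2xZ4_soc2_3, .Z2xZ4_soc2_4, .Z2xZ4_soc2_5, .Z2xZ4_soc2_6,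
    .Z2xZ4_soc4_1, .Z2xZ4_soc4_2, .Z2xZ4_soc4_3, .Z2xZ4_soc4_4, .Z2xZ4_soc4_5, .Z2xZ4_soc4_6,
    .Z2xZ4_soc8,
    .Z2xZ2xZ2_soc1,
    .Z2xZ2xZ2_soc2_1, .Z2xZ2xZ2_soc2_2, .Z2xZ2xZ2_soc2_3, .Z2xZ2xZ2_soc2_4,
    .Z2xZ2xZ2_soc4_1, .Z2xZ2xZ2_soc4_2,
    .Z2xZ2xZ2_soc8]

/-- The position of a label in the list of all labels is its constructor index. -/
theorem getElem?_all (i : BraceLabel) : all[i.ctorIdx]? = some i := by cases i <;> rfl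

theorem mem_all (i : BraceLabel) : i ∈ all := List.mem_of_getElem? (getElem?_all i)

theorem ctorIdx_inj {i j : BraceLabel} (h : i.ctorIdx = j.ctorIdx) : i = j :=
  Option.some_injective _ ((getElem?_all i).symm.trans (h ▸ getElem?_all j))

end BraceLabel

/-- The code of an entry with respect to the flag `4, 2, 1` of `ℤ/8`, the flag
`(0, 2), (1, 0), (0, 1)` of `ℤ/2 × ℤ/4`, or the standard basis of `(ℤ/2)³`. -/
def flagCodeOf : BraceLabel → FlagCode
  | .Z8_soc2 =>
      { dbl := { wv := true, uw := true }, actW := { uv := true },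
        actU := { wv := true, uw := true } }
  | .Z8_soc4_1 => { dbl := { wv := true, uw := true }, actU := { wv := true, uw := true } }
  | .Z8_soc4_2 => { dbl := { wv := true, uw := true }, actU := { uv := true } }
  | .Z8_soc4_3 =>
      { dbl := { wv := true, uw := true }, actU := { wv := true, uv := true, uw := true } }
  | .Z8_soc8 => { dbl := { wv := true, uw := true } }
  | .Z2xZ4_soc1 =>
      { dbl := { uv := true }, actV := { uw := true }, actW := { uv := true, uw := true },
        actU := { wv := true, uw := true } }
  | .Z2xZ4_soc2_1 => { dbl := { uv := true }, actW := { wv := true }, actU := { uv := true } }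
  | .Z2xZ4_soc2_2 =>
      { dbl := { uv := true }, actW := { wv := true }, actU := { wv := true, uv := true } }
  | .Z2xZ4_soc2_3 => { dbl := { uv := true }, actW := { uv := true }, actU := { wv := true } }
  | .Z2xZ4_soc2_4 =>
      { dbl := { uv := true }, actW := { uv := true }, actU := { wv := true, uv := true } }
  | .Z2xZ4_soc2_5 =>
      { dbl := { uv := true }, actW := { uv := true }, actU := { wv := true, uw := true } }
  | .Z2xZ4_soc2_6 => { dbl := { uv := true }, actV := { uw := true }, actU := { uv := true } }
  | .Z2xZ4_soc4_1 => { dbl := { uv := true }, actW := { uv := true } }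
  | .Z2xZ4_soc4_2 => { dbl := { uv := true }, actU := { uv := true } }
  | .Z2xZ4_soc4_3 => { dbl := { uv := true }, actU := { wv := true } }
  | .Z2xZ4_soc4_4 => { dbl := { uv := true }, actW := { wv := true } }
  | .Z2xZ4_soc4_5 => { dbl := { uv := true }, actW := { wv := true }, actU := { wv := true } }
  | .Z2xZ4_soc4_6 => { dbl := { uv := true }, actU := { uw := true } }
  | .Z2xZ4_soc8 => { dbl := { uv := true } }
  | .Z2xZ2xZ2_soc1 =>
      { actV := { uv := true, uw := true }, actW := { uv := true },
        actU := { wv := true, uw := true } }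
  | .Z2xZ2xZ2_soc2_1 => { actW := { uv := true }, actU := { wv := true } }
  | .Z2xZ2xZ2_soc2_2 => { actW := { wv := true }, actU := { uv := true } }
  | .Z2xZ2xZ2_soc2_3 => { actW := { wv := true }, actU := { wv := true, uv := true } }
  | .Z2xZ2xZ2_soc2_4 => { actW := { uv := true }, actU := { wv := true, uw := true } }
  | .Z2xZ2xZ2_soc4_1 => { actW := { wv := true } }
  | .Z2xZ2xZ2_soc4_2 => { actU := { wv := true } }
  | .Z2xZ2xZ2_soc8 => {}

/-- The conjunction of `f b` over both values of `b`. -/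
def Bool.forAll (f : Bool → Bool) : Bool := f false && f true

theorem Bool.forAll_eq {f : Bool → Bool} : Bool.forAll f = true ↔ ∀ b, f b = true := by
  simp [Bool.forAll]

/-- The conjunction of `f r` over all eight rows `r`. -/
def Row.forAll (f : Row → Bool) : Bool :=
  Bool.forAll fun a => Bool.forAll fun b => Bool.forAll fun d => f ⟨a, b, d⟩

theorem Row.forAll_eq {f : Row → Bool} : Row.forAll f = true ↔ ∀ r, f r = true := by
  simp only [Row.forAll, Bool.forAll_eq]
  exact ⟨fun h r => h r.wv r.uv r.uw, fun h a b d => h ⟨a, b, d⟩⟩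

/-- The doubling maps `d` and `e` belong to isomorphic additive groups: the group is cyclic if
`wv` and `uw` are nonzero and elementary abelian if all digits vanish. -/
def Row.sameType (d e : Row) : Bool :=
  ((d.wv && d.uw) == (e.wv && e.uw)) && ((d.wv || d.uv || d.uw) == (e.wv || e.uv || e.uw))

/-- Every code that satisfies the necessary conditions is the code of a flag of some entry. The
conditions on `λ_v`, `λ_w`, `λ_u` are tested one after the other, which leaves few of the 4096
codes, and only entries with the same additive group are searched. -/
theorem exists_label_check : (Row.forAll fun d => Row.forAll fun p =>
    !(compat d p && !p.wv) || Row.forAll fun q => !(compat d q && !(p.uw && q.wv)) ||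
      Row.forAll fun r => !(compat d r && assocOn ⟨d, p, q, r⟩ [.v, .w, .u]) ||
        BraceLabel.all.any fun i =>
          d.sameType (flagCodeOf i).dbl && hasFlag (flagCodeOf i) ⟨d, p, q, r⟩) = true := by
  decide +kernel

/-- If entry `i` has a flag with the code of entry `j`, then `i` does not come after `j`. As two
isomorphic entries have each other's codes, this separates the entries. -/
theorem hasFlag_check : (BraceLabel.all.all fun i => BraceLabel.all.all fun j =>
    decide (i.ctorIdx ≤ j.ctorIdx) || !hasFlag (flagCodeOf i) (flagCodeOf j)) = true := by
  decide +kernel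

/-- Necessary conditions on the code of a flag. -/
theorem relations_of_isFlag {G : Type*} [AddCommGroup G] [Group G] [IsLeftBrace G] {c : FlagCode}
    {v w u : G} (hG : Nat.card G = 8) (h : IsFlag c v w u) :
    compat c.dbl c.actV = true ∧ compat c.dbl c.actW = true ∧ compat c.dbl c.actU = true ∧
      ∀ l, assocOn c l = true := by
  simp only [compat, beq_iff_eq]
  refine ⟨h.digit_eq_digit c.actV v h.mul_v.1 h.mul_w.1 h.mul_u.1,
    h.digit_eq_digit c.actW w h.mul_v.2.1 h.mul_w.2.1 h.mul_u.2.1,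
    h.digit_eq_digit c.actU u h.mul_v.2.2 h.mul_w.2.2 h.mul_u.2.2, fun l => ?_⟩
  have hc := h.isCoord hG
  simp only [assocOn, List.all_eq_true, Bits.force_eq, Bits.eq_iff]
  intro x _ y _ z _
  apply hc.bijective.injective
  simp only [hc.map_mul, mul_assoc]

theorem exists_label {G : Type*} [AddCommGroup G] [Group G] [IsLeftBrace G] {c : FlagCode}
    {v w u : G} (hG : Nat.card G = 8) (h : IsFlag c v w u) :
    ∃ i, hasFlag (flagCodeOf i) c = true := by
  obtain ⟨h₁, h₂, h₃, h₄⟩ := relations_of_isFlag hG h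
  have key := exists_label_check
  simp only [Row.forAll_eq] at key
  have key := key c.dbl c.actV
  simp only [h₁, h.actV_wv, Bool.not_false, Bool.and_self, Bool.not_true, Bool.false_or,
    Row.forAll_eq] at key
  have key := key c.actW
  simp only [h₂, h.actV_uw_and_actW_wv, Bool.not_false, Bool.and_self, Bool.not_true,
    Bool.false_or, Row.forAll_eq] at key
  have key := key c.actU
  simp only [h₃, h₄, Bool.and_self, Bool.not_true, Bool.false_or, List.any_eq_true,
    Bool.and_eq_true] at key
  obtain ⟨i, -, -, hi⟩ := key
  exact ⟨i, hi⟩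

/-- `d` identifies the entry `E` with the digit vectors, on which `c` defines addition and
multiplication. In contrast to `IsCoord`, it is not assumed that `E` is a group under its
multiplication. -/
structure HasCoord (E : BraceEntry) (c : FlagCode) (d : Bits → E.carrier) : Prop where
  bijective : Function.Bijective d
  map_add (x y : Bits) : d (c.add x y) = d x + d y
  map_mul (x y : Bits) : d (c.mul x y) = E.mul (d x) (d y)

/-- The digits with respect to the flag `4, 2, 1` of `ℤ/8`. -/
def coordZ8 : Bits → ZMod 8 := comb 4 2 1

/-- The digits with respect to the flag `(0, 2), (1, 0), (0, 1)` of `ℤ/2 × ℤ/4`. -/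
def coordZ2xZ4 : Bits → ZMod 2 × ZMod 4 := comb (0, 2) (1, 0) (0, 1)

/-- The digits with respect to the standard basis of `(ℤ/2)³`. -/
def coordZ2xZ2xZ2 : Bits → ZMod 2 × ZMod 2 × ZMod 2 := comb (1, 0, 0) (0, 1, 0) (0, 0, 1)

theorem coordZ8_bijective : Function.Bijective coordZ8 := by decide +kernel
theorem coordZ2xZ4_bijective : Function.Bijective coordZ2xZ4 := by decide +kernel
theorem coordZ2xZ2xZ2_bijective : Function.Bijective coordZ2xZ2xZ2 := by decide +kernel

theorem coordZ8_add {c : FlagCode} (hc : c.dbl = { wv := true, uw := true }) (x y : Bits) :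
    coordZ8 (c.add x y) = coordZ8 x + coordZ8 y :=
  comb_add (by decide) (by rw [hc]; decide) (by rw [hc]; decide) x y

theorem coordZ2xZ4_add {c : FlagCode} (hc : c.dbl = { uv := true }) (x y : Bits) :
    coordZ2xZ4 (c.add x y) = coordZ2xZ4 x + coordZ2xZ4 y :=
  comb_add (by decide) (by rw [hc]; decide) (by rw [hc]; decide) x y

theorem coordZ2xZ2xZ2_add {c : FlagCode} (hc : c.dbl = {}) (x y : Bits) :
    coordZ2xZ2xZ2 (c.add x y) = coordZ2xZ2xZ2 x + coordZ2xZ2xZ2 y :=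
  comb_add (by decide) (by rw [hc]; decide) (by rw [hc]; decide) x y

theorem hasCoord_onZ8 {s M m} {c : FlagCode} (hc : c.dbl = { wv := true, uw := true })
    (h : ∀ x y : Bits, coordZ8 (c.mul x y) = m (coordZ8 x) (coordZ8 y)) :
    HasCoord (.onZ8 s M m) c coordZ8 :=
  ⟨coordZ8_bijective, coordZ8_add hc, h⟩

theorem hasCoord_onZ2xZ4 {s M m} {c : FlagCode} (hc : c.dbl = { uv := true })
    (h : ∀ x y : Bits, coordZ2xZ4 (c.mul x y) =
      m (coordZ2xZ4 x).1 (coordZ2xZ4 x).2 (coordZ2xZ4 y).1 (coordZ2xZ4 y).2) :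
    HasCoord (.onZ2xZ4 s M m) c coordZ2xZ4 :=
  ⟨coordZ2xZ4_bijective, coordZ2xZ4_add hc, h⟩

theorem hasCoord_onZ2xZ2xZ2 {s M m} {c : FlagCode} (hc : c.dbl = {})
    (h : ∀ x y : Bits, coordZ2xZ2xZ2 (c.mul x y) =
      m (coordZ2xZ2xZ2 x).1 (coordZ2xZ2xZ2 x).2.1 (coordZ2xZ2xZ2 x).2.2
        (coordZ2xZ2xZ2 y).1 (coordZ2xZ2xZ2 y).2.1 (coordZ2xZ2xZ2 y).2.2) :
    HasCoord (.onZ2xZ2xZ2 s M m) c coordZ2xZ2xZ2 :=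
  ⟨coordZ2xZ2xZ2_bijective, coordZ2xZ2xZ2_add hc, h⟩

theorem exists_hasCoord (i : BraceLabel) : ∃ d, HasCoord (braceOfOrder8 i) (flagCodeOf i) d := by
  cases i <;> rw [braceOfOrder8] <;> first
    | exact ⟨_, hasCoord_onZ8 rfl (by decide +kernel)⟩
    | exact ⟨_, hasCoord_onZ2xZ4 rfl (by decide +kernel)⟩
    | exact ⟨_, hasCoord_onZ2xZ2xZ2 rfl (by decide +kernel)⟩

/-! ### The multiplicative groups of the entries -/

namespace FlagCode

/-- Powers with respect to `mul`; the neutral element is the zero vector. -/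
def pow (c : FlagCode) (x : Bits) : ℕ → Bits
  | 0 => .zero
  | n + 1 => c.mul x (c.pow x n)

/-- The map `k ↦ a^k`. -/
def toZ8 (c : FlagCode) (a : Bits) (k : Multiplicative (ZMod 8)) : Bits :=
  c.pow a k.toAdd.val

/-- The map `(k, l) ↦ a^k b^l`. -/
def toZ2xZ4 (c : FlagCode) (a b : Bits) (k : Multiplicative (ZMod 2 × ZMod 4)) : Bits :=
  c.mul (c.pow a k.toAdd.1.val) (c.pow b k.toAdd.2.val)

/-- The map `(k, l, m) ↦ a^k b^l d^m`. -/
def toZ2xZ2xZ2 (c : FlagCode) (a b d : Bits)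
    (k : Multiplicative (ZMod 2 × ZMod 2 × ZMod 2)) : Bits :=
  c.mul (c.pow a k.toAdd.1.val) (c.mul (c.pow b k.toAdd.2.1.val) (c.pow d k.toAdd.2.2.val))

/-- The map `r^i ↦ a^i`, `s r^i ↦ b a^i`. -/
def toD4 (c : FlagCode) (a b : Bits) : DihedralGroup 4 → Bits
  | .r i => c.pow a i.val
  | .sr i => c.mul b (c.pow a i.val)

/-- The map `a^i ↦ a^i`, `x a^i ↦ b a^i`. -/
def toQ (c : FlagCode) (a b : Bits) : QuaternionGroup 2 → Bits
  | .a i => c.pow a i.val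
  | .xa i => c.mul b (c.pow a i.val)

/-- `f` respects multiplication and only `1` has the same image as `1`. If `N` has order `8`, then
`f` is an isomorphism; that `mul` is a group operation need not be known for this. -/
def IsIso (c : FlagCode) {N : Type} [Group N] (f : N → Bits) : Prop :=
  (∀ x : N, f x = f 1 → x = 1) ∧ ∀ x y : N, f (x * y) = c.mul (f x) (f y)

instance (c : FlagCode) {N : Type} [Group N] [Fintype N] [DecidableEq N] (f : N → Bits) :
    Decidable (c.IsIso f) :=
  inferInstanceAs (Decidable (_ ∧ _))

theorem IsIso.bijective {c : FlagCode} {N : Type} [Group N] {f : N → Bits} (hf : c.IsIso f)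
    (hN : Nat.card N = 8) : Function.Bijective f := by
  have : Finite N := Nat.finite_of_card_ne_zero (by omega)
  refine Function.Injective.bijective_of_nat_card_le (fun x y h => ?_) (by simp [hN])
  have e : f (x⁻¹ * y) = f 1 := by rw [hf.2, ← h, ← hf.2, inv_mul_cancel]
  exact (inv_mul_eq_one.1 (hf.1 _ e))

/-- `mul` makes `Bits` a group that is isomorphic to the group with the given name. -/
def HasGroupType (c : FlagCode) : GroupName → Prop
  | .Z8 => ∃ f : Multiplicative (ZMod 8) → Bits, c.IsIso f
  | .Z2xZ4 => ∃ f : Multiplicative (ZMod 2 × ZMod 4) → Bits, c.IsIso f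
  | .Z2xZ2xZ2 => ∃ f : Multiplicative (ZMod 2 × ZMod 2 × ZMod 2) → Bits, c.IsIso f
  | .D4 => ∃ f : DihedralGroup 4 → Bits, c.IsIso f
  | .Q => ∃ f : QuaternionGroup 2 → Bits, c.IsIso f

/-- The search for generators that define an isomorphism as in `HasGroupType`. -/
def groupCheck (c : FlagCode) : GroupName → Bool
  | .Z8 => Bits.all.any fun a => c.IsIso (c.toZ8 a)
  | .Z2xZ4 => Bits.all.any fun a => Bits.all.any fun b => c.IsIso (c.toZ2xZ4 a b)
  | .Z2xZ2xZ2 => Bits.all.any fun a => Bits.all.any fun b => Bits.all.any fun d =>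
      c.IsIso (c.toZ2xZ2xZ2 a b d)
  | .D4 => Bits.all.any fun a => Bits.all.any fun b => c.IsIso (c.toD4 a b)
  | .Q => Bits.all.any fun a => Bits.all.any fun b => c.IsIso (c.toQ a b)

theorem group_check : (BraceLabel.all.all fun i =>
    groupCheck (flagCodeOf i) (braceOfOrder8 i).mulGroup) = true := by
  decide +kernel

theorem hasGroupType (i : BraceLabel) :
    HasGroupType (flagCodeOf i) (braceOfOrder8 i).mulGroup := by
  have h := List.all_eq_true.1 group_check i i.mem_all
  generalize (braceOfOrder8 i).mulGroup = M at h
  cases M <;> simp only [groupCheck, List.any_eq_true, decide_eq_true_eq] at h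
  · obtain ⟨a, -, h⟩ := h
    exact ⟨_, h⟩
  · obtain ⟨a, -, b, -, h⟩ := h
    exact ⟨_, h⟩
  · obtain ⟨a, -, b, -, d, -, h⟩ := h
    exact ⟨_, h⟩
  · obtain ⟨a, -, b, -, h⟩ := h
    exact ⟨_, h⟩
  · obtain ⟨a, -, b, -, h⟩ := h
    exact ⟨_, h⟩

end FlagCode

theorem HasCoord.exists_group {E : BraceEntry} {c : FlagCode} {d : Bits → E.carrier}
    (hd : HasCoord E c d) {N : Type} [Group N] (hN : Nat.card N = 8) {f : N → Bits}
    (hf : c.IsIso f) :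
    ∃ _ : Group E.carrier, (∀ x y : E.carrier, x * y = E.mul x y) ∧
      Nonempty (E.carrier ≃* N) := by
  let e : N ≃ E.carrier := (Equiv.ofBijective f (hf.bijective hN)).trans
    (Equiv.ofBijective d hd.bijective)
  refine ⟨e.symm.group, fun x y => ?_, ⟨e.symm.mulEquiv⟩⟩
  rw [e.symm.mul_def, e.symm_symm]
  have he (z : N) : e z = d (f z) := rfl
  rw [he, hf.2, hd.map_mul, ← he, ← he, e.apply_symm_apply, e.apply_symm_apply]

theorem HasCoord.exists_group_of_hasGroupType {E : BraceEntry} {c : FlagCode}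
    {d : Bits → E.carrier} (hd : HasCoord E c d) {M : GroupName} (hM : c.HasGroupType M) :
    ∃ _ : Group E.carrier, (∀ x y : E.carrier, x * y = E.mul x y) ∧ M.IsTypeOf E.carrier := by
  cases M <;> obtain ⟨f, hf⟩ := hM
  · exact hd.exists_group (by simp) hf
  · exact hd.exists_group (by simp) hf
  · exact hd.exists_group (by simp) hf
  · exact hd.exists_group (by rw [DihedralGroup.nat_card]) hf
  · exact hd.exists_group (by rw [Nat.card_eq_fintype_card, QuaternionGroup.card]) hf

/-! ### Socles and the brace law -/

/-- The condition `λ_x = id` in digits. -/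
def FlagCode.inSocle (c : FlagCode) (x : Bits) : Bool :=
  Bits.all.all fun y => (c.mul x y).eq (c.add x y)

theorem socle_check : (BraceLabel.all.all fun i =>
    (Bits.all.filter (flagCodeOf i).inSocle).length == (braceOfOrder8 i).socleOrder) = true := by
  decide +kernel

theorem leftDistrib_check :
    (BraceLabel.all.all fun i => leftDistrib (flagCodeOf i)) = true := by
  decide +kernel

theorem mem_socle_iff {B : Type*} [AddCommGroup B] [Group B] {a : B} :
    a ∈ socle B ↔ ∀ b, a * b = a + b := by
  simp only [socle, Set.mem_ofPred_eq, funext_iff, lambdaMap, id, sub_eq_iff_eq_add']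

theorem card_socle_of_isCoord {G : Type*} [AddCommGroup G] [Group G] {c : FlagCode}
    {d : Bits → G} (hd : IsCoord c d) :
    Nat.card (socle G) = (Bits.all.filter c.inSocle).length := by
  have h : ∀ x : Bits, c.inSocle x = true ↔ d x ∈ socle G := by
    intro x
    simp only [inSocle, List.all_eq_true, Bits.eq_iff, mem_socle_iff,
      ← hd.bijective.injective.eq_iff, hd.map_mul, hd.map_add, hd.bijective.surjective.forall]
    exact ⟨fun h y => h y y.mem_all, fun h y _ => h y⟩
  rw [← Nat.card_congr ((Equiv.ofBijective d hd.bijective).subtypeEquiv h)]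
  have hn : Bits.all.Nodup := by decide
  rw [← List.toFinset_card_of_nodup (hn.filter _)]
  exact Nat.subtype_card _ fun x => by simp [Bits.mem_all]

theorem card_socle_congr {G H : Type*} [AddCommGroup G] [Group G] [AddCommGroup H] [Group H]
    (e : G ≃+ H) (he : ∀ x y, e (x * y) = e x * e y) :
    Nat.card (socle G) = Nat.card (socle H) := by
  refine Nat.card_congr (e.toEquiv.subtypeEquiv fun x => ?_)
  change _ ↔ e x ∈ _
  simp only [mem_socle_iff, e.surjective.forall, ← he, ← map_add, e.injective.eq_iff]

/-- Every entry is correct, and has coordinates for its code as a left brace. -/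
theorem isCorrect (i : BraceLabel) :
    ∃ _ : Group (braceOfOrder8 i).carrier,
      (∀ x y : (braceOfOrder8 i).carrier, x * y = (braceOfOrder8 i).mul x y) ∧
      IsLeftBrace (braceOfOrder8 i).carrier ∧
      Nat.card (socle (braceOfOrder8 i).carrier) = (braceOfOrder8 i).socleOrder ∧
      (braceOfOrder8 i).mulGroup.IsTypeOf (braceOfOrder8 i).carrier ∧
      ∃ d : Bits → (braceOfOrder8 i).carrier, IsCoord (flagCodeOf i) d := by
  obtain ⟨d, hd⟩ := exists_hasCoord i
  obtain ⟨inst, hmul, hM⟩ := hd.exists_group_of_hasGroupType (hasGroupType i)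
  have hc : IsCoord (flagCodeOf i) d :=
    ⟨hd.bijective, hd.map_add, fun x y => by rw [hmul, hd.map_mul]⟩
  refine ⟨inst, hmul, ⟨?_⟩, ?_, hM, d, hc⟩
  · have h := List.all_eq_true.1 leftDistrib_check i i.mem_all
    simp only [leftDistrib, List.all_eq_true, Bits.force_eq, Bits.eq_iff] at h
    simp only [hd.bijective.surjective.forall, ← hc.map_mul, ← hc.map_add]
    exact fun x y z => congrArg d (h x x.mem_all y y.mem_all z z.mem_all)
  · rw [card_socle_of_isCoord hc]
    exact beq_iff_eq.1 (List.all_eq_true.1 socle_check i i.mem_all)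

theorem isFlag_flagCodeOf {G : Type*} [AddCommGroup G] [Group G] {i : BraceLabel} {d : Bits → G}
    (hd : IsCoord (flagCodeOf i) d) : IsFlag (flagCodeOf i) (d .v) (d .w) (d .u) := by
  rw [← hd.isFlag_iff]
  cases i <;> decide

/-! ### Classification -/

theorem exists_isIsoTo {G : Type*} [AddCommGroup G] [Group G] [IsLeftBrace G]
    (hG : Nat.card G = 8) : ∃ i : BraceLabel, (braceOfOrder8 i).IsIsoTo G := by
  obtain ⟨c, v, w, u, h⟩ := exists_isFlag hG
  obtain ⟨i, hi⟩ := exists_label hG h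
  obtain ⟨inst, hmul, hb, -, -, d, hd⟩ := isCorrect i
  -- `G` and the entry have flags with the same code
  obtain ⟨v', w', u', h'⟩ := hd.exists_isFlag_of_hasFlag hi
  obtain ⟨e, he⟩ := (h.isCoord hG).exists_equiv
    (h'.isCoord ((Nat.card_eq_of_bijective d hd.bijective).symm.trans (by simp)))
  exact ⟨i, e, fun x y => by rw [he, hmul]⟩

theorem label_eq_of_isIsoTo {G : Type*} [AddCommGroup G] [Group G] {i j : BraceLabel}
    (hi : (braceOfOrder8 i).IsIsoTo G) (hj : (braceOfOrder8 j).IsIsoTo G) : i = j := by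
  have key : ∀ {i j : BraceLabel}, (braceOfOrder8 i).IsIsoTo G → (braceOfOrder8 j).IsIsoTo G →
      i.ctorIdx ≤ j.ctorIdx := by
    rintro i j ⟨e, he⟩ ⟨e', he'⟩
    obtain ⟨_, hmul, -, -, -, d, hd⟩ := isCorrect i
    obtain ⟨_, hmul', -, -, -, d', hd'⟩ := isCorrect j
    -- a flag of entry `j` with its own code, carried over to entry `i`
    have hf := ((isFlag_flagCodeOf hd').map e'.symm fun x y => by
      rw [e'.symm_apply_eq, he', e'.apply_symm_apply, e'.apply_symm_apply, hmul']).map e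
        fun x y => by rw [he, hmul]
    have h := hasFlag_check
    simp only [List.all_eq_true, Bool.or_eq_true, decide_eq_true_eq] at h
    simpa [hd.hasFlag_of_isFlag hf] using h i i.mem_all j j.mem_all
  exact BraceLabel.ctorIdx_inj (le_antisymm (key hi hj) (key hj hi))

theorem mainTheorem2 :
    -- every entry of the list is a left brace with the asserted socle order and group
    (∀ i : BraceLabel, (braceOfOrder8 i).IsCorrect) ∧
    -- every left brace of order `8` is isomorphic to exactly one entry of the list
    (∀ (G : Type*) [AddCommGroup G] [Group G] [IsLeftBrace G], Nat.card G = 8 →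
      ∃! i : BraceLabel, (braceOfOrder8 i).IsIsoTo G) ∧
    -- the ones with trivial socle: one for `ℤ/2 × ℤ/4` and one for `(ℤ/2)³`, with group `D₄`
    (∀ (G : Type*) [AddCommGroup G] [Group G] [IsLeftBrace G], Nat.card G = 8 →
      Nat.card (IsLeftBrace.socle G) = 1 →
      Nonempty (G ≃* DihedralGroup 4) ∧
      ((Nonempty (G ≃+ ZMod 2 × ZMod 4) ∧ (braceOfOrder8 .Z2xZ4_soc1).IsIsoTo G) ∨
        (Nonempty (G ≃+ ZMod 2 × ZMod 2 × ZMod 2) ∧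
          (braceOfOrder8 .Z2xZ2xZ2_soc1).IsIsoTo G))) := by
  refine ⟨fun i => ?_, fun G _ _ _ hG => ?_, fun G _ _ _ hG hs => ?_⟩
  · obtain ⟨inst, hmul, hb, hs, hM, -⟩ := isCorrect i
    exact ⟨inst, hmul, hb, hs, hM⟩
  · obtain ⟨i, hi⟩ := exists_isIsoTo hG
    exact ⟨i, hi, fun j hj => label_eq_of_isIsoTo hj hi⟩
  · obtain ⟨i, e, he⟩ := exists_isIsoTo hG
    obtain ⟨inst, hmul, hb, hs', hM, -⟩ := isCorrect i
    have he' : ∀ x y, e (x * y) = e x * e y := fun x y => by rw [he, hmul]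
    rw [card_socle_congr e he', hs'] at hs
    have hD : (braceOfOrder8 i).mulGroup = .D4 := by cases i <;> first | rfl | cases hs
    rw [hD] at hM
    obtain ⟨f⟩ := hM
    refine ⟨⟨(MulEquiv.mk e.toEquiv he').trans f⟩, ?_⟩
    cases i <;> first
      | cases hs; done
      | exact Or.inl ⟨⟨e⟩, e, he⟩
      | exact Or.inr ⟨⟨e⟩, e, he⟩
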